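/- **Setting.** Let $X$ be a finite set of colours. A pair of filtration functions $f=(f_v,f_e)$ consists of $f_v:X\to\mathbb R$ and a symmetric $f_e:X\times X\to\mathbb R_{>0}$, i.e. a function on the set $X\times X/{\sim}$ of unordered pairs of (possibly equal) colours. Let $n_v=|X|$, $n_e=|X\times X/{\sim}|$, and for $S\subseteq\mathbb R$ let $\operatorname{Conf}_n(S)$ be the set of points of $S^n$ without repeated coordinates, with the subspace topology; if $f_v$ and $f_e$ (on unordered pairs) are injective, then $f$ is a point of $\operatorname{Conf}_{n_v}(\mathbb R)\times\operatorname{Conf}_{n_e}(\mathbb R_{>0})$. Let $G$ be a finite simple graph with vertex colouring $c:V(G)\to X$. For $t\in\mathbb R\cup\{\infty\}$ let $G_t$ be the graph on $V(G)$ with the edges $uw$ of $G$ such that $f_e(c(u),c(w))\le t$. Put $\alpha(v)=f_v(c(v))$ and $\gamma(v)=\min_{w\sim v}f_e(c(v),c(w))$ ($=\infty$ if $v$ is isolated). Start with the vertices, each representing its own component, and add the edges one at a time in order of non-decreasing value $f_e$. An edge of value $t$ joining two components kills one of their two representatives, the one with the greater $\alpha$, in a tie the one with the lower $\gamma$, in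 a further tie either one; the killed vertex gets death time $d(v)=t$, and the other vertex represents the merged component. Vertices never killed have $d(v)=\infty$. An edge $e$ inside a component creates a cycle, with birth time $d(e)=t$. The diagram $\operatorname{SpectRe}(G,f)=\operatorname{SpectRe}(G,f)^0\sqcup\operatorname{SpectRe}(G,f)^1$ consists of the multiset of the tuples $(0,d(v),\alpha(v),\gamma(v),\rho(v))$, $v\in V(G)$, and the multiset of the tuples $(1,d(e),0,0,\rho(e))$, $e$ an edge that creates a cycle, where $\rho(v)$ (resp. $\rho(e)$) is the list, with multiplicity, of the non-zero eigenvalues of the Laplacian of the connected component of $G_{d(v)}$ containing $v$ (resp. of $G_{d(e)}$ containing $e$). For tuples $p_i=(b_i,d_i,\alpha_i,\gamma_i,\rho_i)$, $i=0,1$, let $$d'(p_0,p_1)=\max\{|b_0-b_1|,|d_0-d_1|\}+|\alpha_0-\alpha_1|+|\gamma_0-\gamma_1|+\|\phi(\rho_0)-\phi(\rho_1)\|_{\ell^1},$$ where $\phi(\rho)$ is the list $\rho$ in ascending order followed by zeros, $|\infty-\infty|=0$, and $|\infty-a|=\infty$ for real $a$. For finite multisets $A,B$ of tuples of the same cardinality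 let $\operatorname{Bott}(A,B)=\inf_\pi\max_{p\in A}d'(p,\pi(p))$ over all bijections $\pi:A\to B$, and put $$d_B^{\operatorname{Spec}R}(\operatorname{SpectRe}(G,f),\operatorname{SpectRe}(G,g))=\sum_{i=0,1}\operatorname{Bott}(\operatorname{SpectRe}(G,f)^i,\operatorname{SpectRe}(G,g)^i).$$ **Theorem.** (Local stability.) Let $f=(f_v,f_e)\in\operatorname{Conf}_{n_v}(\mathbb R)\times\operatorname{Conf}_{n_e}(\mathbb R_{>0})$. Then for all $g=(g_v,g_e)$ sufficiently close to $f$ in $\operatorname{Conf}_{n_v}(\mathbb R)\times\operatorname{Conf}_{n_e}(\mathbb R_{>0})$, and every finite simple graph $G$ with vertices coloured by $X$, $$d_B^{\operatorname{Spec}R}(\operatorname{SpectRe}(G,f),\operatorname{SpectRe}(G,g))\le 3\|f_e-g_e\|_\infty+\|f_v-g_v\|_\infty,$$ whatever choices are made in the order of edges of equal value and in the remaining ties. (No global stability.) There is a coloured graph $G$ with $4$ vertices and $2$ colours such that for every $C\in\mathbb R$ there are $f,g\in\operatorname{Conf}_{2}(\mathbb R)\times\operatorname{Conf}_{3}(\mathbb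 R_{>0})$ with $$d_B^{\operatorname{Spec}R}(\operatorname{SpectRe}(G,f),\operatorname{SpectRe}(G,g))> C\,\bigl(\|f_e-g_e\|_\infty+\|f_v-g_v\|_\infty\bigr).$$ -/

import Mathlib

open Filter Topology
open scoped ENNReal

namespace SpectRe

/-- The points of `S ^ ι` without repeated coordinates, with the subspace topology of `ι → ℝ`. -/
abbrev Conf (ι : Type*) (S : Set ℝ) : Type _ :=
  {x : ι → ℝ // Function.Injective x ∧ ∀ i, x i ∈ S}

/-- A pair of filtration functions on a colour set `X`: a real function on the colours and a
positive symmetric function of two colours, i.e. a positive function of unordered pairs of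
(possibly equal) colours. -/
structure ColorFiltration (X : Type*) where
  fv : X → ℝ
  fe : Sym2 X → ℝ
  fe_pos : ∀ p, 0 < fe p

/-- The pair of filtration functions given by a point of `Conf(ℝ) × Conf(ℝ_{>0})`. -/
def ColorFiltration.ofConf {X : Type*} (f : Conf X Set.univ × Conf (Sym2 X) (Set.Ioi 0)) :
    ColorFiltration X where
  fv := f.1.1
  fe := f.2.1
  fe_pos := f.2.2.2

section Graph

variable {X V : Type*} [Fintype V] (G : SimpleGraph V) (c : V → X) (f : ColorFiltration X)

/-- The value of the edge filtration function on the edge `e`. -/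
def edgeValue {X V : Type*} (c : V → X) (f : ColorFiltration X) (e : Sym2 V) : ℝ :=
  f.fe (e.map c)

/-- The sublevel graph of the edge filtration at time `t`. All vertices have value `0`, so they are
present from time `0` on, before any edge; at time `t = ⊤` (i.e. `∞`) it is the whole graph. -/
def sublevel {X V : Type*} (G : SimpleGraph V) (c : V → X) (f : ColorFiltration X)
    (t : WithTop ℝ) : SimpleGraph V where
  Adj x y := G.Adj x y ∧ (edgeValue c f s(x, y) : WithTop ℝ) ≤ t
  symm := ⟨fun x y h => ⟨h.1.symm, by rw [Sym2.eq_swap]; exact h.2⟩⟩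
  loopless := ⟨fun x h => G.loopless.irrefl x h.1⟩

/-- The `α` component of a vertex. -/
def alpha {X V : Type*} (c : V → X) (f : ColorFiltration X) (v : V) : ℝ := f.fv (c v)

open Classical in
/-- The `γ` component of a vertex: the minimal value of an edge at `v`
(the minimum over the empty set, for an isolated vertex, is `∞`). -/
noncomputable def gamma (v : V) : WithTop ℝ :=
  (Finset.univ.filter fun w => G.Adj v w).inf fun w => (edgeValue c f s(v, w) : WithTop ℝ)

open Classical in
/-- The non-zero eigenvalues, with multiplicity, of the Laplacian of a finite graph. -/
noncomputable def nonzeroSpectrum {W : Type*} [Fintype W] (H : SimpleGraph W) : Multiset ℝ :=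
  (H.lapMatrix ℝ).charpoly.roots.filter fun r => r ≠ 0

open Classical in
/-- The non-zero Laplacian eigenvalues of the connected component of `v` at time `t`. -/
noncomputable def rho (t : WithTop ℝ) (v : V) : Multiset ℝ :=
  nonzeroSpectrum ((sublevel G c f t).connectedComponentMk v).toSimpleGraph

/-- The decision rule: when the components represented by `v` and `w` merge, `v` may be killed if
it has the greater `α`, or the same `α` and the lower `γ`. In a further tie, either may be killed. -/
def MayKill (v w : V) : Prop :=
  alpha c f w < alpha c f v ∨ (alpha c f v = alpha c f w ∧ gamma G c f v ≤ gamma G c f w)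

/-- The bookkeeping while the edges are added one at a time: the edges added so far, the vertex
that represents the component of each vertex, the death times assigned so far (`⊤` for a vertex
that has not died), and the edges that created a cycle. -/
structure State (V : Type*) where
  added : Set (Sym2 V)
  rep : V → V
  death : V → WithTop ℝ
  cycles : Multiset (Sym2 V)

/-- `e` can be added next: it is an edge not yet added, of minimal filtration value among those. -/
def IsNext {X V : Type*} (G : SimpleGraph V) (c : V → X) (f : ColorFiltration X)
    (added : Set (Sym2 V)) (e : Sym2 V) : Prop :=
  e ∈ G.edgeSet ∧ e ∉ added ∧
    ∀ e' ∈ G.edgeSet, e' ∉ added → edgeValue c f e ≤ edgeValue c f e'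

open Classical in
/-- The states that the computation of persistence pairs in the edge filtration can reach. The edges
are added in an order compatible with the filtration. An edge between two components merges them
and kills one of the two representatives; an edge inside a component creates a cycle. Edges of
equal value may be taken in any order, and ties in the decision rule resolved in any way. -/
inductive Reaches : State V → Prop
  | start : Reaches ⟨∅, id, fun _ => ⊤, 0⟩
  | merge (s : State V) (x y : V) : Reaches s → IsNext G c f s.added s(x, y) →
      s.rep x ≠ s.rep y → MayKill G c f (s.rep x) (s.rep y) →
      Reaches ⟨insert s(x, y) s.added,
        fun z => if s.rep z = s.rep x then s.rep y else s.rep z,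
        Function.update s.death (s.rep x) (edgeValue c f s(x, y) : WithTop ℝ),
        s.cycles⟩
  | cycle (s : State V) (x y : V) : Reaches s → IsNext G c f s.added s(x, y) →
      s.rep x = s.rep y →
      Reaches ⟨insert s(x, y) s.added, s.rep, s.death, s(x, y) ::ₘ s.cycles⟩

end Graph

/-- A tuple `(b, d, α, γ, ρ)`. -/
structure Point where
  birth : ℝ
  death : WithTop ℝ
  alpha : ℝ
  gamma : WithTop ℝ
  rho : Multiset ℝ

/-- A diagram: its 0-dimensional and its 1-dimensional component. -/
structure Diagram where
  dim0 : Multiset Point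
  dim1 : Multiset Point

/-- `D` is the SpectRe diagram of the coloured graph `(G, c)` with respect to `f`, computed from a
run that has added all edges. In dimension 1, the component that contains the edge `e` at its time
is that of an endpoint (`Quot.out e` lists the two endpoints in some order). -/
def IsDiagram {X V : Type*} [Fintype V] (G : SimpleGraph V) (c : V → X) (f : ColorFiltration X)
    (D : Diagram) : Prop :=
  ∃ s : State V, Reaches G c f s ∧ s.added = G.edgeSet ∧
    D.dim0 = Finset.univ.val.map (fun v =>
      ⟨0, s.death v, alpha c f v, gamma G c f v, rho G c f (s.death v) v⟩) ∧
    D.dim1 = s.cycles.map (fun e =>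
      ⟨1, edgeValue c f e, 0, 0, rho G c f (edgeValue c f e) (Quot.out e).1⟩)

/-- `|a - b|` for extended reals `a, b ∈ ℝ ∪ {∞}`, with `|∞ - ∞| = 0`. -/
noncomputable def absDiff : WithTop ℝ → WithTop ℝ → ℝ≥0∞
  | (a : ℝ), (b : ℝ) => ENNReal.ofReal |a - b|
  | ⊤, ⊤ => 0
  | _, _ => ⊤

/-- The sequence that starts with the elements of `ρ` in ascending order, followed by zeros. -/
noncomputable def sortedSeq (ρ : Multiset ℝ) (n : ℕ) : ℝ := (ρ.sort (· ≤ ·)).getD n 0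

/-- The `ℓ¹` distance of the sorted lists of eigenvalues, extended by zeros. -/
noncomputable def specDist (ρ₀ ρ₁ : Multiset ℝ) : ℝ≥0∞ :=
  ∑' n, ENNReal.ofReal |sortedSeq ρ₀ n - sortedSeq ρ₁ n|

/-- The distance `max{|b₀ - b₁|, |d₀ - d₁|} + |α₀ - α₁| + |γ₀ - γ₁| + d^Spec(ρ₀, ρ₁)`. -/
noncomputable def pointDist (p q : Point) : ℝ≥0∞ :=
  max (ENNReal.ofReal |p.birth - q.birth|) (absDiff p.death q.death)
    + ENNReal.ofReal |p.alpha - q.alpha| + absDiff p.gamma q.gamma + specDist p.rho q.rho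

open Classical in
/-- The infimum over all bijections `π : A → B` of `max_{p ∈ A} d (p, π p)`, for multisets
`A` and `B`. -/
noncomputable def bott {α : Type*} (A B : Multiset α) (d : α → α → ℝ≥0∞) : ℝ≥0∞ :=
  ⨅ π : A.ToType ≃ B.ToType, ⨆ p : A.ToType, d p.1 (π p).1

/-- The bottleneck distance of two SpectRe diagrams. -/
noncomputable def bottleneckDist (D E : Diagram) : ℝ≥0∞ :=
  bott D.dim0 E.dim0 pointDist + bott D.dim1 E.dim1 pointDist

/-- Every coloured graph has a SpectRe diagram, for any filtration functions. -/
theorem exists_isDiagram {X V : Type*} [Fintype V] (G : SimpleGraph V) (c : V → X)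
    (f : ColorFiltration X) : ∃ D, IsDiagram G c f D := by
  classical
  have key : ∀ n : ℕ, ∀ s : State V, Reaches G c f s → (G.edgeSet \ s.added).ncard = n →
      s.added ⊆ G.edgeSet → ∃ s' : State V, Reaches G c f s' ∧ s'.added = G.edgeSet := by
    intro n
    induction n with
    | zero =>
      intro s hs hn hsub
      rw [Set.ncard_eq_zero (Set.toFinite _)] at hn
      exact ⟨s, hs, hsub.antisymm (Set.sdiff_eq_empty.mp hn)⟩
    | succ n ih =>
      intro s hs hn hsub
      have hne : (G.edgeSet \ s.added).Nonempty := by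
        rw [Set.nonempty_iff_ne_empty]
        intro h
        rw [h] at hn
        simp at hn
      obtain ⟨e, he, hmin⟩ := Set.exists_min_image _ (edgeValue c f) (Set.toFinite _) hne
      have hnext : IsNext G c f s.added e := ⟨he.1, he.2, fun e' h1 h2 => hmin e' ⟨h1, h2⟩⟩
      have hcard : (G.edgeSet \ insert e s.added).ncard = n := by
        have h1 : G.edgeSet \ insert e s.added = (G.edgeSet \ s.added) \ {e} := by
          ext z
          simp only [Set.mem_sdiff, Set.mem_insert_iff, Set.mem_singleton_iff]
          tauto
        rw [h1, Set.ncard_sdiff_singleton_of_mem he, hn]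
        rfl
      have hsub' : insert e s.added ⊆ G.edgeSet := Set.insert_subset he.1 hsub
      induction e with
      | _ x y =>
        by_cases hxy : s.rep x = s.rep y
        · exact ih _ (Reaches.cycle s x y hs hnext hxy) hcard hsub'
        · by_cases hk : MayKill G c f (s.rep x) (s.rep y)
          · exact ih _ (Reaches.merge s x y hs hnext hxy hk) hcard hsub'
          · have hk' : MayKill G c f (s.rep y) (s.rep x) := by
              unfold MayKill at hk ⊢
              push Not at hk
              rcases hk.1.lt_or_eq with h | h
              · exact Or.inl h
              · exact Or.inr ⟨h.symm, (hk.2 h).le⟩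
            rw [Sym2.eq_swap] at hnext hcard hsub'
            exact ih _ (Reaches.merge s y x hs hnext (Ne.symm hxy) hk') hcard hsub'
  obtain ⟨s, hs, hadd⟩ := key _ _ Reaches.start rfl (Set.empty_subset _)
  exact ⟨⟨_, _⟩, s, hs, hadd, rfl, rfl⟩

end SpectRe

/-!
The points `f` and `g` of the configuration space that are close to each other induce the same order
on the colours and on the pairs of colours, since the finitely many coordinates of `f` are distinct
(`eventually_sameOrder`). A run of the persistence algorithm depends on the filtration functions only
through these orders, so a run for `f` is also a run for `g`, with corresponding death times
(`SameOrder.exists_reaches`). The sublevel graphs at corresponding times coincide, so the spectra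
agree. Matching every vertex and every cycle-creating edge with itself costs
`‖f_e - g_e‖ + ‖f_v - g_v‖ + ‖f_e - g_e‖` in dimension 0 (from the death time, `α` and `γ`) and
`‖f_e - g_e‖` in dimension 1 (`SameOrder.bottleneckDist_le`).

The given diagram of `g` may come from a different run. It is nevertheless the same diagram
(`IsDiagram.unique`). The decision rule compares vertices by a total preorder, so the representative
of a component is always one of its least vertices, and its `α` and `γ` do not depend on the run.
For an initial segment `T` of the time line, the vertices whose death time is not in `T` represent
the components of the graph formed by the edges with values in `T` (`Reaches.exists_isElderRep`).
Comparing the initial segments `(-∞, d)` and `(-∞, d]`, one finds the number of vertices that die at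
time `d` in a given component with given `α` and `γ` (`Reaches.ncard_death_eq`). In dimension 1, every
edge either creates a cycle or kills a vertex, so the cycle-creating edges of a given value in a given
component are counted by the difference (`Reaches.map_edgeLabel`).

For the failure of global stability, take a path with colours `false, false, true, true` and fixed
edge values for which the vertices of colour `false` have `γ = 2` and those of colour `true` have
`γ ≥ 3`. Exactly one vertex survives, of the colour with the smaller vertex value. Exchanging two
vertex values at distance `ε` thus moves the `γ` of the only point with infinite death time by at
least `1` (`one_le_bottleneckDist`).
-/

namespace SpectRe

/-! ### The elder rule -/

section ElderRule

variable {X V : Type*} [Fintype V] {G : SimpleGraph V} {c : V → X} {f : ColorFiltration X}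

lemma MayKill.refl (v : V) : MayKill G c f v v := Or.inr ⟨rfl, le_rfl⟩

lemma MayKill.trans {u v w : V} (h₁ : MayKill G c f u v) (h₂ : MayKill G c f v w) :
    MayKill G c f u w := by
  rcases h₁ with h₁ | ⟨h₁, h₁'⟩ <;> rcases h₂ with h₂ | ⟨h₂, h₂'⟩
  · exact Or.inl (h₂.trans h₁)
  · exact Or.inl (h₂ ▸ h₁)
  · exact Or.inl (h₁ ▸ h₂)
  · exact Or.inr ⟨h₁.trans h₂, h₁'.trans h₂'⟩

/-- Two vertices that may kill each other have the same `α` and `γ`: the choice left open by the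
decision rule does not affect these components. -/
lemma MayKill.antisymm {v w : V} (h₁ : MayKill G c f v w) (h₂ : MayKill G c f w v) :
    alpha c f v = alpha c f w ∧ gamma G c f v = gamma G c f w := by
  rcases h₁ with h₁ | ⟨h₁, h₁'⟩ <;> rcases h₂ with h₂ | ⟨h₂, h₂'⟩
  · exact absurd h₁ h₂.asymm
  · exact absurd h₂ h₁.ne
  · exact absurd h₁ h₂.ne
  · exact ⟨h₁, le_antisymm h₁' h₂'⟩

variable (G c f) in
/-- The function `r` selects in each connected component of `H` one vertex that all vertices of the
component may be killed by. -/
structure IsElderRep (H : SimpleGraph V) (r : V → V) : Prop where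
  reachable : ∀ v, H.Reachable v (r v)
  eq_of_adj : ∀ v w, H.Adj v w → r v = r w
  mayKill : ∀ v, MayKill G c f v (r v)

namespace IsElderRep

variable {H : SimpleGraph V} {r r' : V → V}

lemma eq_of_reachable (h : IsElderRep G c f H r) {v w : V} (hvw : H.Reachable v w) :
    r v = r w := by
  obtain ⟨p⟩ := hvw
  induction p with
  | nil => rfl
  | cons hadj _ ih => exact (h.eq_of_adj _ _ hadj).trans ih

lemma eq_iff (h : IsElderRep G c f H r) {v w : V} : r v = r w ↔ H.Reachable v w :=
  ⟨fun e => (h.reachable v).trans (e ▸ (h.reachable w).symm), h.eq_of_reachable⟩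

lemma idem (h : IsElderRep G c f H r) (v : V) : r (r v) = r v :=
  (h.eq_of_reachable (h.reachable v)).symm

/-- Two choices of representatives agree on `α` and `γ`. -/
lemma alpha_gamma_eq (h : IsElderRep G c f H r) (h' : IsElderRep G c f H r') {v : V}
    (hv : r v = v) :
    alpha c f v = alpha c f (r' v) ∧ gamma G c f v = gamma G c f (r' v) := by
  have h1 := h.mayKill (r' v)
  rw [← h.eq_of_reachable (h'.reachable v), hv] at h1
  exact (h'.mayKill v).antisymm h1

/-- The number of representatives with given `α` and `γ` in a union of connected components does
not depend on the choice of the representatives. -/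
lemma ncard_eq (h : IsElderRep G c f H r) (h' : IsElderRep G c f H r') {P : V → Prop}
    (hP : ∀ v w, H.Reachable v w → P v → P w) (a : ℝ) (b : WithTop ℝ) :
    {v | r v = v ∧ P v ∧ alpha c f v = a ∧ gamma G c f v = b}.ncard =
      {v | r' v = v ∧ P v ∧ alpha c f v = a ∧ gamma G c f v = b}.ncard := by
  have key : ∀ {r r' : V → V}, IsElderRep G c f H r → IsElderRep G c f H r' →
      {v | r v = v ∧ P v ∧ alpha c f v = a ∧ gamma G c f v = b}.ncard ≤
      {v | r' v = v ∧ P v ∧ alpha c f v = a ∧ gamma G c f v = b}.ncard := by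
    intro r r' h h'
    refine Set.ncard_le_ncard_of_injOn r' ?_ ?_ (Set.toFinite _)
    · rintro v ⟨h1, h2, h3, h4⟩
      obtain ⟨h5, h6⟩ := h.alpha_gamma_eq h' h1
      exact ⟨h'.idem v, hP _ _ (h'.reachable v) h2, h5 ▸ h3, h6 ▸ h4⟩
    · rintro v ⟨h1, -⟩ w ⟨h2, -⟩ hvw
      rw [← h1, ← h2]
      exact h.eq_iff.2 (h'.eq_iff.1 hvw)
  exact (key h h').antisymm (key h' h)

/-- Adding an edge between two components whose representatives are compared by the rule. -/
lemma merge {A : Set (Sym2 V)} {x y : V} [DecidableEq V]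
    (h : IsElderRep G c f (SimpleGraph.fromEdgeSet A) r) (hne : r x ≠ r y)
    (hk : MayKill G c f (r x) (r y)) :
    IsElderRep G c f (SimpleGraph.fromEdgeSet (insert s(x, y) A))
      (fun z => if r z = r x then r y else r z) := by
  have hmono : SimpleGraph.fromEdgeSet A ≤ SimpleGraph.fromEdgeSet (insert s(x, y) A) :=
    SimpleGraph.fromEdgeSet_mono (Set.subset_insert _ _)
  have hxy : (SimpleGraph.fromEdgeSet (insert s(x, y) A)).Adj x y := by
    rw [SimpleGraph.fromEdgeSet_adj]
    exact ⟨Set.mem_insert _ _, fun e => hne (e ▸ rfl)⟩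
  refine ⟨fun z => ?_, fun v w hvw => ?_, fun z => ?_⟩
  · split_ifs with hz
    · exact ((h.eq_iff.1 hz).mono hmono).trans (hxy.reachable.trans ((h.reachable y).mono hmono))
    · exact (h.reachable z).mono hmono
  · rw [SimpleGraph.fromEdgeSet_adj, Set.mem_insert_iff, Sym2.eq_iff] at hvw
    obtain ⟨(⟨rfl, rfl⟩ | ⟨rfl, rfl⟩) | hA, hvw⟩ := hvw
    · simp
    · simp
    · rw [h.eq_of_adj v w ((SimpleGraph.fromEdgeSet_adj _).2 ⟨hA, hvw⟩)]
  · split_ifs with hz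
    · exact (hz ▸ h.mayKill z).trans hk
    · exact h.mayKill z

lemma cycle {A : Set (Sym2 V)} {x y : V}
    (h : IsElderRep G c f (SimpleGraph.fromEdgeSet A) r) (he : r x = r y) :
    IsElderRep G c f (SimpleGraph.fromEdgeSet (insert s(x, y) A)) r := by
  refine ⟨fun z => (h.reachable z).mono (SimpleGraph.fromEdgeSet_mono (Set.subset_insert _ _)),
    fun v w hvw => ?_, h.mayKill⟩
  rw [SimpleGraph.fromEdgeSet_adj, Set.mem_insert_iff, Sym2.eq_iff] at hvw
  obtain ⟨(⟨rfl, rfl⟩ | ⟨rfl, rfl⟩) | hA, hvw⟩ := hvw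
  · exact he
  · exact he.symm
  · exact h.eq_of_adj v w ((SimpleGraph.fromEdgeSet_adj _).2 ⟨hA, hvw⟩)

end IsElderRep

/-! ### Invariants of a run -/

namespace Reaches

variable {s : State V}

lemma added_subset (h : Reaches G c f s) : s.added ⊆ G.edgeSet := by
  induction h with
  | start => exact Set.empty_subset _
  | merge s x y _ hn _ _ ih => exact Set.insert_subset hn.1 ih
  | cycle s x y _ hn _ ih => exact Set.insert_subset hn.1 ih

lemma edgeValue_le (h : Reaches G c f s) : ∀ e ∈ s.added, ∀ e' ∈ G.edgeSet, e' ∉ s.added →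
    edgeValue c f e ≤ edgeValue c f e' := by
  have step : ∀ (A : Set (Sym2 V)) (e₀ : Sym2 V), IsNext G c f A e₀ →
      (∀ e ∈ A, ∀ e' ∈ G.edgeSet, e' ∉ A → edgeValue c f e ≤ edgeValue c f e') →
      ∀ e ∈ insert e₀ A, ∀ e' ∈ G.edgeSet, e' ∉ insert e₀ A →
        edgeValue c f e ≤ edgeValue c f e' := by
    rintro A e₀ hn ih e (rfl | he) e' he' hA
    · exact hn.2.2 e' he' fun h => hA (Set.mem_insert_of_mem _ h)
    · exact ih e he e' he' fun h => hA (Set.mem_insert_of_mem _ h)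
  induction h with
  | start => simp
  | merge s x y _ hn _ _ ih => exact step _ _ hn ih
  | cycle s x y _ hn _ ih => exact step _ _ hn ih

lemma isElderRep (h : Reaches G c f s) :
    IsElderRep G c f (SimpleGraph.fromEdgeSet s.added) s.rep := by
  classical
  induction h with
  | start => exact ⟨fun _ => .rfl, fun v w hvw => by simp at hvw, fun v => MayKill.refl v⟩
  | merge s x y _ _ hne hk ih => convert ih.merge hne hk
  | cycle s x y _ _ he ih => exact ih.cycle he

/-- The vertices that have not died are those that represent their component. -/
lemma rep_eq_self_iff (h : Reaches G c f s) (v : V) : s.rep v = v ↔ s.death v = ⊤ := by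
  classical
  induction h with
  | start => simp
  | merge s x y hs hn hne hk ih =>
    have hid := hs.isElderRep.idem x
    dsimp only
    by_cases hv : v = s.rep x
    · subst hv
      simp [hid, hne.symm]
    · rw [Function.update_of_ne hv, ← ih]
      split_ifs with h1
      · constructor
        · rintro rfl
          exact hs.isElderRep.idem y
        · intro h2
          exact absurd (h2.symm.trans h1) hv
      · rfl
  | cycle s x y _ _ _ ih => exact ih

lemma exists_of_death_eq (h : Reaches G c f s) {v : V} {τ : ℝ} (hv : s.death v = τ) :
    ∃ e ∈ s.added, edgeValue c f e = τ := by
  classical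
  induction h with
  | start => simp at hv
  | merge s x y hs hn hne hk ih =>
    dsimp only at hv ⊢
    by_cases hvx : v = s.rep x
    · subst hvx
      rw [Function.update_self] at hv
      exact ⟨_, Set.mem_insert _ _, WithTop.coe_injective hv⟩
    · rw [Function.update_of_ne hvx] at hv
      obtain ⟨e, he, h⟩ := ih hv
      exact ⟨e, Set.mem_insert_of_mem _ he, h⟩
  | cycle s x y _ _ _ ih =>
    obtain ⟨e, he, h⟩ := ih hv
    exact ⟨e, Set.mem_insert_of_mem _ he, h⟩

/-- A run has, for every initial segment `T` of the time line, a stage at which precisely the edges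
with values in `T` have been added; the vertices alive at this stage are those whose final death
time is not in `T`. -/
lemma exists_isElderRep (h : Reaches G c f s) {T : Set ℝ} (hT : IsLowerSet T) :
    ∃ r, IsElderRep G c f (SimpleGraph.fromEdgeSet {e ∈ s.added | edgeValue c f e ∈ T}) r ∧
      ∀ v, r v = v ↔ ¬ ∃ τ ∈ T, s.death v = (τ : ℝ) := by
  classical
  -- If the last edge has its value in `T`, so have all earlier ones, and the present
  -- representatives will do. Otherwise, the representatives of the preceding state will do.
  have all : ∀ {s : State V}, Reaches G c f s → (∀ e ∈ s.added, edgeValue c f e ∈ T) →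
      ∃ r, IsElderRep G c f (SimpleGraph.fromEdgeSet {e ∈ s.added | edgeValue c f e ∈ T}) r ∧
      ∀ v, r v = v ↔ ¬ ∃ τ ∈ T, s.death v = (τ : ℝ) := by
    intro s hs ht
    refine ⟨s.rep, ?_, fun v => ?_⟩
    · rw [show {e ∈ s.added | edgeValue c f e ∈ T} = s.added from Set.sep_eq_self_iff_mem_true.2 ht]
      exact hs.isElderRep
    · rw [hs.rep_eq_self_iff]
      constructor
      · rintro hv ⟨τ, -, h⟩
        simp [hv] at h
      · intro hv
        by_contra hne
        obtain ⟨τ, hτ⟩ := WithTop.ne_top_iff_exists.1 hne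
        obtain ⟨e, he, rfl⟩ := hs.exists_of_death_eq hτ.symm
        exact hv ⟨_, ht e he, hτ.symm⟩
  have mem : ∀ {s : State V}, Reaches G c f s → ∀ {e}, IsNext G c f s.added e →
      edgeValue c f e ∈ T → ∀ e' ∈ insert e s.added, edgeValue c f e' ∈ T := by
    rintro s hs e hn he e' (rfl | he')
    · exact he
    · exact hT (hs.edgeValue_le e' he' e hn.1 hn.2.1) he
  have notMem : ∀ {A : Set (Sym2 V)} {e}, edgeValue c f e ∉ T →
      {e' ∈ insert e A | edgeValue c f e' ∈ T} = {e' ∈ A | edgeValue c f e' ∈ T} := by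
    intro A e he
    ext e'
    simp only [Set.mem_insert_iff, Set.mem_ofPred_eq]
    constructor
    · rintro ⟨rfl | h1, h2⟩
      · exact absurd h2 he
      · exact ⟨h1, h2⟩
    · rintro ⟨h1, h2⟩
      exact ⟨Or.inr h1, h2⟩
  induction h with
  | start => exact all .start (by simp)
  | merge s x y hs hn hne hk ih =>
    by_cases he : edgeValue c f s(x, y) ∈ T
    · exact all (.merge s x y hs hn hne hk) (mem hs hn he)
    · obtain ⟨r, hr, hr'⟩ := ih
      refine ⟨r, by simpa only [notMem he] using hr, fun v => ?_⟩
      rw [hr' v, not_iff_not]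
      by_cases hv : v = s.rep x
      · subst hv
        have htop := (hs.rep_eq_self_iff _).1 (hs.isElderRep.idem x)
        simp only [Function.update_self, htop, WithTop.coe_inj, WithTop.top_ne_coe, and_false,
          exists_false, false_iff]
        rintro ⟨τ, hτ, h⟩
        exact he (h ▸ hτ)
      · simp only [Function.update_of_ne hv]
  | cycle s x y hs hn hxy ih =>
    by_cases he : edgeValue c f s(x, y) ∈ T
    · exact all (.cycle s x y hs hn hxy) (mem hs hn he)
    · obtain ⟨r, hr, hr'⟩ := ih
      exact ⟨r, by simpa only [notMem he] using hr, hr'⟩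

end Reaches

end ElderRule

/-! ### The diagram does not depend on the run -/

section Components

variable {X V : Type*} {G : SimpleGraph V} {c : V → X} {f : ColorFiltration X}

lemma fromEdgeSet_le_sublevel {A : Set (Sym2 V)} {t : WithTop ℝ} (hA : A ⊆ G.edgeSet)
    (ht : ∀ e ∈ A, (edgeValue c f e : WithTop ℝ) ≤ t) :
    SimpleGraph.fromEdgeSet A ≤ sublevel G c f t := by
  intro x y hxy
  rw [SimpleGraph.fromEdgeSet_adj] at hxy
  exact ⟨(SimpleGraph.mem_edgeSet G).1 (hA hxy.1), ht _ hxy.1⟩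

variable (G c f) in
/-- The time `d` and the connected component of `v` at time `d`, as a set of vertices. -/
def componentLabel (d : WithTop ℝ) (v : V) : WithTop ℝ × Set V :=
  (d, {w | (sublevel G c f d).Reachable w v})

lemma componentLabel_eq_of_reachable {d : WithTop ℝ} {v w : V}
    (h : (sublevel G c f d).Reachable v w) :
    componentLabel G c f d v = componentLabel G c f d w := by
  unfold componentLabel
  congr 1
  ext u
  exact ⟨fun hu => hu.trans h, fun hu => hu.trans h.symm⟩

variable (G c f) in
/-- The value of an edge and the component that contains it at that time. -/
noncomputable def edgeLabel (e : Sym2 V) : WithTop ℝ × Set V :=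
  componentLabel G c f (edgeValue c f e) (Quot.out e).1

lemma edgeLabel_mk {x y : V} (h : G.Adj x y) :
    edgeLabel G c f s(x, y) = componentLabel G c f (edgeValue c f s(x, y)) x := by
  apply componentLabel_eq_of_reachable
  have hxy : (sublevel G c f (edgeValue c f s(x, y))).Adj x y := ⟨h, le_rfl⟩
  have hout : s((Quot.out s(x, y)).1, (Quot.out s(x, y)).2) = s(x, y) := Quot.out_eq _
  rw [Sym2.eq_iff] at hout
  obtain ⟨h1, -⟩ | ⟨h1, -⟩ := hout
  · rw [h1]
  · rw [h1]
    exact hxy.reachable.symm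

variable (G c f) in
/-- The label of a vertex with death time `d`, as a multiset that is empty for `d = ∞`. -/
noncomputable def deadLabel (d : WithTop ℝ) (v : V) : Multiset (WithTop ℝ × Set V) :=
  if d = ⊤ then 0 else {componentLabel G c f d v}

@[simp] lemma deadLabel_top (v : V) : deadLabel G c f ⊤ v = 0 := if_pos rfl

lemma deadLabel_coe (d : ℝ) (v : V) : deadLabel G c f d v = {componentLabel G c f d v} :=
  if_neg WithTop.coe_ne_top

end Components

lemma count_map_univ {V β : Type*} [Fintype V] [DecidableEq β] (L : V → β) (b : β) :
    (Finset.univ.val.map L).count b = {v | L v = b}.ncard := by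
  classical
  rw [Multiset.count_map, ← Finset.filter_val, Finset.card_val, ← Set.ncard_coe_finset]
  congr 1
  ext v
  simp [eq_comm]

section Uniqueness

variable {X V : Type*} [Fintype V] {G : SimpleGraph V} {c : V → X} {f : ColorFiltration X}

/-- The number of vertices with given death time `d`, `α` and `γ` in a union of connected
components at time `d` is the same for all runs. For finite `d` it is the number of representatives
just before `d` minus the number of representatives at `d`. -/
lemma Reaches.ncard_death_eq {s s' : State V} (h : Reaches G c f s) (hs : s.added = G.edgeSet)
    (h' : Reaches G c f s') (hs' : s'.added = G.edgeSet) (d : WithTop ℝ) {P : V → Prop}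
    (hP : ∀ v w, (sublevel G c f d).Reachable v w → P v → P w) (a : ℝ) (b : WithTop ℝ) :
    {v | s.death v = d ∧ P v ∧ alpha c f v = a ∧ gamma G c f v = b}.ncard =
      {v | s'.death v = d ∧ P v ∧ alpha c f v = a ∧ gamma G c f v = b}.ncard := by
  have alive : ∀ T : Set ℝ, IsLowerSet T → (∀ τ ∈ T, (τ : WithTop ℝ) ≤ d) →
      {v | (¬ ∃ τ ∈ T, s.death v = (τ : ℝ)) ∧ P v ∧ alpha c f v = a ∧ gamma G c f v = b}.ncard =
      {v | (¬ ∃ τ ∈ T, s'.death v = (τ : ℝ)) ∧ P v ∧ alpha c f v = a ∧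
        gamma G c f v = b}.ncard := by
    intro T hT hd
    obtain ⟨r, hr, hr1⟩ := h.exists_isElderRep hT
    obtain ⟨r', hr', hr1'⟩ := h'.exists_isElderRep hT
    rw [hs] at hr
    rw [hs'] at hr'
    simp only [← hr1, ← hr1']
    refine hr.ncard_eq hr' (fun v w hvw => hP v w (hvw.mono ?_)) a b
    exact fromEdgeSet_le_sublevel (fun e he => he.1) fun e he => hd _ he.2
  cases d with
  | top =>
    have hdeath : ∀ x : WithTop ℝ, x = ⊤ ↔ ¬ ∃ τ ∈ (Set.univ : Set ℝ), x = (τ : ℝ) := by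
      intro x
      cases x <;> simp
    simp only [hdeath]
    exact alive _ isLowerSet_univ (by simp)
  | coe d =>
    have split : ∀ s : State V,
        {v | (¬ ∃ τ ∈ Set.Iio d, s.death v = (τ : ℝ)) ∧ P v ∧ alpha c f v = a ∧
          gamma G c f v = b}.ncard =
        {v | s.death v = d ∧ P v ∧ alpha c f v = a ∧ gamma G c f v = b}.ncard +
        {v | (¬ ∃ τ ∈ Set.Iic d, s.death v = (τ : ℝ)) ∧ P v ∧ alpha c f v = a ∧
          gamma G c f v = b}.ncard := by
      intro s
      rw [← Set.ncard_union_eq _ (Set.toFinite _) (Set.toFinite _)]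
      · congr 1
        ext v
        have : (¬ ∃ τ ∈ Set.Iio d, s.death v = (τ : ℝ)) ↔
            s.death v = d ∨ ¬ ∃ τ ∈ Set.Iic d, s.death v = (τ : ℝ) := by
          cases s.death v with
          | top => simp
          | coe x =>
            simp only [Set.mem_Iio, WithTop.coe_inj, exists_eq_right', Set.mem_Iic, not_lt, not_le]
            rw [le_iff_eq_or_lt, eq_comm]
        simp only [Set.mem_ofPred_eq, Set.mem_union, this]
        tauto
      · rw [Set.disjoint_left]
        rintro v ⟨h1, -⟩ ⟨h2, -⟩
        exact h2 ⟨d, Set.mem_Iic.2 le_rfl, h1⟩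
    have h1 := alive (Set.Iio d) (isLowerSet_Iio d)
      fun τ hτ => WithTop.coe_le_coe.2 (le_of_lt hτ)
    have h2 := alive (Set.Iic d) (isLowerSet_Iic d) fun τ hτ => WithTop.coe_le_coe.2 hτ
    rw [split s, split s', h2] at h1
    exact Nat.add_right_cancel h1

lemma rho_eq_of_reachable {d : WithTop ℝ} {v w : V} (h : (sublevel G c f d).Reachable v w) :
    rho G c f d v = rho G c f d w := by
  unfold rho
  rw [SimpleGraph.ConnectedComponent.sound h]

variable (G c f) in
open Classical in
/-- The spectrum of the component with a given label. -/
noncomputable def labelRho (l : WithTop ℝ × Set V) : Multiset ℝ :=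
  if h : l.2.Nonempty then rho G c f l.1 h.some else 0

lemma labelRho_componentLabel (d : WithTop ℝ) (v : V) :
    labelRho G c f (componentLabel G c f d v) = rho G c f d v := by
  have h : (componentLabel G c f d v).2.Nonempty := ⟨v, SimpleGraph.Reachable.refl v⟩
  rw [labelRho, dif_pos h]
  exact rho_eq_of_reachable h.some_mem

/-- The multiset of all data of the vertices, with components in place of spectra, is the same for
all runs. -/
lemma Reaches.map_label_eq {s s' : State V} (h : Reaches G c f s) (hs : s.added = G.edgeSet)
    (h' : Reaches G c f s') (hs' : s'.added = G.edgeSet) :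
    Finset.univ.val.map (fun v =>
      (componentLabel G c f (s.death v) v, alpha c f v, gamma G c f v)) =
    Finset.univ.val.map (fun v =>
      (componentLabel G c f (s'.death v) v, alpha c f v, gamma G c f v)) := by
  classical
  ext ⟨⟨d, S⟩, a, b⟩
  rw [count_map_univ, count_map_univ]
  by_cases hS : ∃ v₀, S = {w | (sublevel G c f d).Reachable w v₀}
  · obtain ⟨v₀, rfl⟩ := hS
    have key : ∀ s : State V, {v | (componentLabel G c f (s.death v) v, alpha c f v,
        gamma G c f v) = ((d, {w | (sublevel G c f d).Reachable w v₀}), a, b)} =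
        {v | s.death v = d ∧ (sublevel G c f d).Reachable v v₀ ∧ alpha c f v = a ∧
          gamma G c f v = b} := by
      intro s
      ext v
      simp only [Set.mem_ofPred_eq, Prod.mk.injEq]
      constructor
      · rintro ⟨h1, h2, h3⟩
        have hd : s.death v = d := congrArg Prod.fst h1
        have hv : v ∈ (componentLabel G c f (s.death v) v).2 := SimpleGraph.Reachable.refl v
        rw [h1] at hv
        exact ⟨hd, hv, h2, h3⟩
      · rintro ⟨rfl, h1, h2, h3⟩
        exact ⟨componentLabel_eq_of_reachable h1, h2, h3⟩
    rw [key, key]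
    exact h.ncard_death_eq hs h' hs' d (fun v w hvw hv => hvw.symm.trans hv) a b
  · have key : ∀ s : State V, {v | (componentLabel G c f (s.death v) v, alpha c f v,
        gamma G c f v) = ((d, S), a, b)} = ∅ := by
      intro s
      rw [Set.eq_empty_iff_forall_notMem]
      intro v hv
      simp only [componentLabel, Set.mem_ofPred_eq, Prod.mk.injEq] at hv
      obtain ⟨⟨rfl, rfl⟩, -⟩ := hv
      exact hS ⟨v, rfl⟩
    rw [key, key]

open Classical in
/-- Every edge added so far has created a cycle or has killed a vertex of its component. -/
lemma Reaches.map_edgeLabel {s : State V} (h : Reaches G c f s) :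
    (Set.toFinite s.added).toFinset.val.map (edgeLabel G c f) =
      s.cycles.map (edgeLabel G c f) +
        ∑ v, deadLabel G c f (s.death v) v := by
  have insert_eq : ∀ (A : Set (Sym2 V)) (e : Sym2 V), e ∉ A →
      (Set.toFinite (insert e A)).toFinset.val.map (edgeLabel G c f) =
        edgeLabel G c f e ::ₘ (Set.toFinite A).toFinset.val.map (edgeLabel G c f) := by
    intro A e he
    rw [← Multiset.map_cons]
    congr 1
    rw [← Finset.cons_val (h := by simpa using he)]
    congr 1
    ext
    simp
  induction h with
  | start => simp
  | merge s x y hs hn hne hk ih =>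
    have hx : s.death (s.rep x) = ⊤ := (hs.rep_eq_self_iff _).1 (hs.isElderRep.idem x)
    have hr : (sublevel G c f (edgeValue c f s(x, y))).Reachable x (s.rep x) :=
      (hs.isElderRep.reachable x).mono (fromEdgeSet_le_sublevel hs.added_subset
        fun e he => WithTop.coe_le_coe.2 (hs.edgeValue_le e he _ hn.1 hn.2.1))
    rw [insert_eq _ _ hn.2.1, ih, edgeLabel_mk hn.1, componentLabel_eq_of_reachable hr,
      ← Finset.add_sum_erase _ _ (Finset.mem_univ (s.rep x)),
      ← Finset.add_sum_erase _ _ (Finset.mem_univ (s.rep x))]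
    dsimp only
    rw [hx, deadLabel_top, Function.update_self, deadLabel_coe, zero_add,
      ← Multiset.singleton_add, add_left_comm]
    congr 2
    refine Finset.sum_congr rfl fun v hv => ?_
    rw [Function.update_of_ne (Finset.ne_of_mem_erase hv)]
  | cycle s x y hs hn hxy ih =>
    rw [insert_eq _ _ hn.2.1, ih, Multiset.map_cons, Multiset.cons_add]

/-- All runs lead to the same diagram. -/
theorem IsDiagram.unique {D E : Diagram} (hD : IsDiagram G c f D) (hE : IsDiagram G c f E) :
    D = E := by
  classical
  obtain ⟨s, h, hs, h0, h1⟩ := hD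
  obtain ⟨s', h', hs', h0', h1'⟩ := hE
  have hlabel := h.map_label_eq hs h' hs'
  have hdead : ∑ v, deadLabel G c f (s.death v) v = ∑ v, deadLabel G c f (s'.death v) v := by
    have := congrArg (fun M => (M.map fun l : (WithTop ℝ × Set V) × ℝ × WithTop ℝ =>
      if l.1.1 = ⊤ then (0 : Multiset _) else {l.1}).sum) hlabel
    rwa [Multiset.map_map, Multiset.map_map] at this
  have hcycles : s.cycles.map (edgeLabel G c f) = s'.cycles.map (edgeLabel G c f) := by
    have e := h.map_edgeLabel
    have e' := h'.map_edgeLabel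
    simp only [hs] at e
    simp only [hs'] at e'
    rw [e, hdead] at e'
    exact add_right_cancel e'
  have e0 : D.dim0 = E.dim0 := by
    have := congrArg (Multiset.map fun l : (WithTop ℝ × Set V) × ℝ × WithTop ℝ =>
      (⟨0, l.1.1, l.2.1, l.2.2, labelRho G c f l.1⟩ : Point)) hlabel
    simp only [Multiset.map_map, Function.comp_def, labelRho_componentLabel] at this
    rw [h0, h0']
    exact this
  have e1 : D.dim1 = E.dim1 := by
    have := congrArg (Multiset.map fun l : WithTop ℝ × Set V =>
      (⟨1, l.1, 0, 0, labelRho G c f l⟩ : Point)) hcycles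
    simp only [Multiset.map_map, Function.comp_def, edgeLabel, labelRho_componentLabel] at this
    rw [h1, h1']
    exact this
  cases D
  cases E
  exact congrArg₂ Diagram.mk e0 e1

end Uniqueness

/-! ### The bottleneck distance -/

section Bott

variable {α ι : Type*} {d : α → α → ℝ≥0∞} {K : ℝ≥0∞}

lemma bott_map_le (M : Multiset ι) {F F' : ι → α} (h : ∀ i, d (F i) (F' i) ≤ K) :
    bott (M.map F) (M.map F') d ≤ K := by
  classical
  refine iInf_le_of_le ((M.mapEquiv F).symm.trans (M.mapEquiv F')) (iSup_le fun p => ?_)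
  obtain ⟨i, rfl⟩ := (M.mapEquiv F).surjective p
  rw [Equiv.trans_apply, Equiv.symm_apply_apply, Multiset.mapEquiv_apply, Multiset.mapEquiv_apply]
  exact h _

lemma le_bott {A B : Multiset α} {p : α} (hp : p ∈ A) (h : ∀ q ∈ B, K ≤ d p q) :
    K ≤ bott A B d := by
  classical
  refine le_iInf fun π => le_trans ?_ (le_iSup _ (A.mkToType p ⟨0, Multiset.count_pos.2 hp⟩))
  exact h _ Multiset.coe_mem

end Bott

/-! ### Filtration functions that induce the same order -/

section SameOrder

variable {X V : Type*}

/-- The functions `f` and `g` induce the same order on the colours and on the pairs of colours. -/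
structure SameOrder (f g : ColorFiltration X) : Prop where
  fv_le : ∀ x y, f.fv x ≤ f.fv y ↔ g.fv x ≤ g.fv y
  fe_le : ∀ p q, f.fe p ≤ f.fe q ↔ g.fe p ≤ g.fe q

/-- The extended reals `a` and `b` are both `∞`, or the values of `f` and `g` at one and the same
pair of colours. -/
def Corresponds (f g : ColorFiltration X) (a b : WithTop ℝ) : Prop :=
  (a = ⊤ ∧ b = ⊤) ∨ ∃ p, a = f.fe p ∧ b = g.fe p

variable {G : SimpleGraph V} {c : V → X} {f g : ColorFiltration X}

lemma Corresponds.absDiff_le {a b : WithTop ℝ} (h : Corresponds f g a b) {ε : ℝ}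
    (hε : ∀ p, |f.fe p - g.fe p| ≤ ε) : absDiff a b ≤ ENNReal.ofReal ε := by
  obtain ⟨rfl, rfl⟩ | ⟨p, rfl, rfl⟩ := h
  · exact zero_le
  · exact ENNReal.ofReal_le_ofReal (hε p)

namespace SameOrder

variable (h : SameOrder f g)
include h

lemma le_iff {a a' b b' : WithTop ℝ} (h₁ : Corresponds f g a b) (h₂ : Corresponds f g a' b') :
    a ≤ a' ↔ b ≤ b' := by
  obtain ⟨rfl, rfl⟩ | ⟨p, rfl, rfl⟩ := h₁ <;> obtain ⟨rfl, rfl⟩ | ⟨q, rfl, rfl⟩ := h₂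
  · simp
  · simp
  · simp
  · rw [WithTop.coe_le_coe, WithTop.coe_le_coe, h.fe_le]

lemma sublevel_eq {a b : WithTop ℝ} (hab : Corresponds f g a b) :
    sublevel G c f a = sublevel G c g b := by
  ext x y
  exact and_congr_right fun _ => h.le_iff (Or.inr ⟨_, rfl, rfl⟩) hab

lemma isNext_iff {A : Set (Sym2 V)} {e : Sym2 V} : IsNext G c f A e ↔ IsNext G c g A e := by
  simp only [IsNext, edgeValue, h.fe_le]

variable [Fintype V]

lemma rho_eq {a b : WithTop ℝ} (hab : Corresponds f g a b) (v : V) :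
    rho G c f a v = rho G c g b v := by
  unfold rho
  rw [h.sublevel_eq hab]

/-- The minimum that defines `γ` is attained at the same edge for `f` and `g`. -/
lemma corresponds_gamma (v : V) : Corresponds f g (gamma G c f v) (gamma G c g v) := by
  classical
  unfold gamma
  by_cases hv : (Finset.univ.filter fun w => G.Adj v w).Nonempty
  · obtain ⟨w, hw, hmin⟩ := Finset.exists_min_image _ (fun w => edgeValue c f s(v, w)) hv
    refine Or.inr ⟨s(v, w).map c, ?_, ?_⟩
    · exact le_antisymm (Finset.inf_le hw)
        (Finset.le_inf fun u hu => WithTop.coe_le_coe.2 (hmin u hu))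
    · exact le_antisymm (Finset.inf_le hw)
        (Finset.le_inf fun u hu => WithTop.coe_le_coe.2 ((h.fe_le _ _).1 (hmin u hu)))
  · rw [Finset.not_nonempty_iff_eq_empty] at hv
    left
    constructor <;> convert Finset.inf_empty

lemma mayKill_iff {v w : V} : MayKill G c f v w ↔ MayKill G c g v w := by
  have hα : ∀ v w : V, alpha c f v ≤ alpha c f w ↔ alpha c g v ≤ alpha c g w :=
    fun v w => h.fv_le _ _
  have hγ := h.le_iff (h.corresponds_gamma (G := G) (c := c) v)
    (h.corresponds_gamma (G := G) (c := c) w)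
  simp only [MayKill, lt_iff_le_not_ge, le_antisymm_iff, hα, hγ]

/-- A run for `f` is a run for `g`, with the same merges and the same cycles. -/
lemma exists_reaches {s : State V} (hs : Reaches G c f s) :
    ∃ s', Reaches G c g s' ∧ s'.added = s.added ∧ s'.rep = s.rep ∧ s'.cycles = s.cycles ∧
      ∀ v, Corresponds f g (s.death v) (s'.death v) := by
  classical
  induction hs with
  | start => exact ⟨_, .start, rfl, rfl, rfl, fun v => Or.inl ⟨rfl, rfl⟩⟩
  | merge s x y hs hn hne hk ih =>
    obtain ⟨⟨A, r, d, C⟩, hs', rfl, rfl, rfl, hd⟩ := ih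
    refine ⟨_, .merge _ x y hs' (h.isNext_iff.1 hn) hne (h.mayKill_iff.1 hk), rfl, rfl, rfl,
      fun v => ?_⟩
    by_cases hv : v = s.rep x
    · subst hv
      simp only [Function.update_self]
      exact Or.inr ⟨_, rfl, rfl⟩
    · simp only [Function.update_of_ne hv]
      exact hd v
  | cycle s x y hs hn hxy ih =>
    obtain ⟨⟨A, r, d, C⟩, hs', rfl, rfl, rfl, hd⟩ := ih
    exact ⟨_, .cycle _ x y hs' (h.isNext_iff.1 hn) hxy, rfl, rfl, rfl, hd⟩

end SameOrder

lemma specDist_self (ρ : Multiset ℝ) : specDist ρ ρ = 0 := by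
  simp [specDist]

/-- The diagrams of filtration functions that induce the same order are as close as the functions:
the death times and the `γ` components each contribute `ε` in dimension 0, and the death times
contribute `ε` in dimension 1. -/
theorem SameOrder.bottleneckDist_le [Fintype V] (h : SameOrder f g) {ε δ : ℝ} (hε0 : 0 ≤ ε)
    (hδ0 : 0 ≤ δ) (hε : ∀ p, |f.fe p - g.fe p| ≤ ε) (hδ : ∀ x, |f.fv x - g.fv x| ≤ δ)
    {D E : Diagram} (hD : IsDiagram G c f D) (hE : IsDiagram G c g E) :
    bottleneckDist D E ≤ ENNReal.ofReal (3 * ε + δ) := by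
  obtain ⟨s, hs, hadd, h0, h1⟩ := hD
  obtain ⟨s', hs', hadd', -, hcyc, hdeath⟩ := h.exists_reaches hs
  have hE' := hE.unique (E := ⟨Finset.univ.val.map fun v =>
      ⟨0, s'.death v, alpha c g v, gamma G c g v, rho G c g (s'.death v) v⟩, s'.cycles.map fun e =>
      ⟨1, edgeValue c g e, 0, 0, rho G c g (edgeValue c g e) (Quot.out e).1⟩⟩)
    ⟨s', hs', hadd'.trans hadd, rfl, rfl⟩
  have e0 : ∀ v, pointDist ⟨0, s.death v, alpha c f v, gamma G c f v, rho G c f (s.death v) v⟩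
      ⟨0, s'.death v, alpha c g v, gamma G c g v, rho G c g (s'.death v) v⟩ ≤
      ENNReal.ofReal ε + ENNReal.ofReal δ + ENNReal.ofReal ε := by
    intro v
    simp only [pointDist, h.rho_eq (hdeath v), specDist_self, add_zero, sub_self, abs_zero,
      ENNReal.ofReal_zero, zero_le, max_eq_right]
    exact add_le_add (add_le_add ((hdeath v).absDiff_le hε) (ENNReal.ofReal_le_ofReal (hδ _)))
      ((h.corresponds_gamma v).absDiff_le hε)
  have e1 : ∀ e, pointDist
      ⟨1, edgeValue c f e, 0, 0, rho G c f (edgeValue c f e) (Quot.out e).1⟩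
      ⟨1, edgeValue c g e, 0, 0, rho G c g (edgeValue c g e) (Quot.out e).1⟩ ≤
      ENNReal.ofReal ε := by
    intro e
    have he : Corresponds f g (edgeValue c f e) (edgeValue c g e) := Or.inr ⟨_, rfl, rfl⟩
    have h00 : absDiff 0 0 = 0 := by
      change ENNReal.ofReal |(0 : ℝ) - 0| = 0
      simp
    simp only [pointDist, h.rho_eq he, specDist_self, add_zero, sub_self, abs_zero,
      ENNReal.ofReal_zero, zero_le, max_eq_right, h00]
    exact he.absDiff_le hε
  rw [hE', bottleneckDist, h0, h1, hcyc]
  refine (add_le_add (bott_map_le _ e0) (bott_map_le _ e1)).trans_eq ?_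
  rw [← ENNReal.ofReal_add hε0 hδ0, ← ENNReal.ofReal_add (by positivity) hε0,
    ← ENNReal.ofReal_add (by positivity) hε0]
  congr 1
  ring

/-- Near a point without repeated coordinates, the order of the coordinates is constant. -/
lemma eventually_le_iff {ι : Type*} [Finite ι] {S : Set ℝ} (x : Conf ι S) :
    ∀ᶠ y in 𝓝 x, ∀ i j, x.1 i ≤ x.1 j ↔ y.1 i ≤ y.1 j := by
  have cont : ∀ i, Continuous fun y : Conf ι S => y.1 i :=
    fun i => (continuous_apply i).comp continuous_subtype_val
  have lt : ∀ i j, x.1 i < x.1 j → ∀ᶠ y in 𝓝 x, y.1 i < y.1 j := fun i j hij =>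
    (cont i).continuousAt.eventually_lt (cont j).continuousAt hij
  rw [eventually_all]
  intro i
  rw [eventually_all]
  intro j
  rcases lt_trichotomy (x.1 i) (x.1 j) with hij | hij | hij
  · filter_upwards [lt i j hij] with y hy
    exact iff_of_true hij.le hy.le
  · obtain rfl := x.2.1 hij
    simp
  · filter_upwards [lt j i hij] with y hy
    exact iff_of_false hij.not_ge hy.not_ge

lemma eventually_sameOrder [Finite X] (f : Conf X Set.univ × Conf (Sym2 X) (Set.Ioi 0)) :
    ∀ᶠ g in 𝓝 f, SameOrder (ColorFiltration.ofConf f) (ColorFiltration.ofConf g) := by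
  filter_upwards [continuous_fst.continuousAt.eventually (eventually_le_iff f.1),
    continuous_snd.continuousAt.eventually (eventually_le_iff f.2)] with g h1 h2
  exact ⟨h1, h2⟩

end SameOrder

/-! ### A path with two colours -/

section Path

/-- In a connected graph, every vertex may be killed by a vertex that never dies. -/
lemma Reaches.mayKill_of_death_eq_top {X V : Type*} [Fintype V] {G : SimpleGraph V} {c : V → X}
    {f : ColorFiltration X} {s : State V} (h : Reaches G c f s) (hs : s.added = G.edgeSet)
    (hG : G.Preconnected) {v : V} (hv : s.death v = ⊤) (w : V) : MayKill G c f w v := by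
  have he := h.isElderRep
  rw [hs, SimpleGraph.fromEdgeSet_edgeSet] at he
  rw [← (h.rep_eq_self_iff v).2 hv, ← he.eq_of_reachable (hG w v)]
  exact he.mayKill w

/-- The colours `false, false, true, true` of the vertices of a path. -/
def pathColor : Fin 4 → Bool := ![false, false, true, true]

/-- The edge filtration function with values `2`, `3`, `4` on the pairs of colours with `0`, `1`,
`2` entries `true`. -/
def colorSum : Conf (Sym2 Bool) (Set.Ioi 0) where
  val := Sym2.lift ⟨fun a b => (if a then 2 else 1) + (if b then 2 else 1),
    fun _ _ => add_comm _ _⟩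
  property := by
    constructor
    · intro p q
      induction p with | _ a b
      induction q with | _ a' b'
      cases a <;> cases b <;> cases a' <;> cases b' <;> norm_num [Sym2.eq_swap]
    · intro p
      induction p with | _ a b
      cases a <;> cases b <;> norm_num

/-- The vertex filtration function with value `0` at the colour `b` and `ε` at the other one. -/
noncomputable def colorStep {ε : ℝ} (hε : 0 < ε) (b : Bool) : Conf Bool Set.univ where
  val a := if a = b then 0 else ε
  property := by
    refine ⟨fun x y => ?_, fun _ => trivial⟩
    cases x <;> cases y <;> cases b <;> simp [hε.ne, hε.ne']

lemma norm_colorStep_sub_le {ε : ℝ} (hε : 0 < ε) (b b' : Bool) :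
    ‖(colorStep hε b).1 - (colorStep hε b').1‖ ≤ ε := by
  rw [pi_norm_le_iff_of_nonneg hε.le]
  intro a
  cases a <;> cases b <;> cases b' <;> simp [colorStep, hε.le, abs_of_pos hε]

variable {ε : ℝ} {hε : 0 < ε} {b : Bool}

/-- Only a vertex of the colour `b` can survive if `colorStep hε b` is the vertex filtration
function. -/
lemma color_eq_of_death_eq_top {s : State (Fin 4)}
    (h : Reaches (SimpleGraph.pathGraph 4) pathColor (.ofConf (colorStep hε b, colorSum)) s)
    (hs : s.added = (SimpleGraph.pathGraph 4).edgeSet) {v : Fin 4} (hv : s.death v = ⊤) :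
    pathColor v = b := by
  obtain ⟨w, hw⟩ : ∃ w, pathColor w = b := by
    cases b
    · exact ⟨0, rfl⟩
    · exact ⟨2, rfl⟩
  by_contra hne
  have := h.mayKill_of_death_eq_top hs (SimpleGraph.pathGraph_connected 3).preconnected hv w
  simp only [MayKill, alpha, ColorFiltration.ofConf, colorStep, hw, if_neg hne, if_true] at this
  rcases this with h | ⟨h, -⟩
  · exact h.not_gt hε
  · exact hε.ne h

lemma gamma_of_color_eq_false {v : Fin 4} (hv : pathColor v = false) :
    gamma (SimpleGraph.pathGraph 4) pathColor (.ofConf (colorStep hε b, colorSum)) v =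
      (2 : ℝ) := by
  obtain ⟨w, hw, hwc⟩ : ∃ w, (SimpleGraph.pathGraph 4).Adj v w ∧ pathColor w = false := by
    fin_cases v
    · exact ⟨1, by simp [SimpleGraph.pathGraph_adj], rfl⟩
    · exact ⟨0, by simp [SimpleGraph.pathGraph_adj], rfl⟩
    · exact absurd hv (by decide)
    · exact absurd hv (by decide)
  classical
  refine le_antisymm ((Finset.inf_le (Finset.mem_filter.2 ⟨Finset.mem_univ w, hw⟩)).trans ?_)
    (Finset.le_inf fun u _ => WithTop.coe_le_coe.2 ?_)
  · refine WithTop.coe_le_coe.2 ?_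
    norm_num [edgeValue, ColorFiltration.ofConf, colorSum, hv, hwc]
  · cases hu : pathColor u <;>
    norm_num [edgeValue, ColorFiltration.ofConf, colorSum, hv, hu]

lemma le_gamma_of_color_eq_true {v : Fin 4} (hv : pathColor v = true) :
    ((3 : ℝ) : WithTop ℝ) ≤
      gamma (SimpleGraph.pathGraph 4) pathColor (.ofConf (colorStep hε b, colorSum)) v := by
  refine Finset.le_inf fun u _ => WithTop.coe_le_coe.2 ?_
  cases hu : pathColor u <;>
  norm_num [edgeValue, ColorFiltration.ofConf, colorSum, hv, hu]

/-- Exchanging the order of the two colours exchanges the colour of the surviving vertex, and moves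
its `γ` component by at least `1`, however close the values at the two colours are. -/
lemma one_le_bottleneckDist {D E : Diagram}
    (hD : IsDiagram (SimpleGraph.pathGraph 4) pathColor
      (.ofConf (colorStep hε false, colorSum)) D)
    (hE : IsDiagram (SimpleGraph.pathGraph 4) pathColor
      (.ofConf (colorStep hε true, colorSum)) E) : 1 ≤ bottleneckDist D E := by
  obtain ⟨s, hs, hadd, h0, -⟩ := hD
  obtain ⟨s', hs', hadd', h0', -⟩ := hE
  refine le_trans ?_ le_self_add
  have hv := (hs.rep_eq_self_iff _).1 (hs.isElderRep.idem 0)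
  have hγ := gamma_of_color_eq_false (hε := hε) (b := false)
    (color_eq_of_death_eq_top hs hadd hv)
  rw [h0, h0']
  refine le_bott (Multiset.mem_map_of_mem _ (Finset.mem_univ (s.rep 0))) ?_
  simp only [Multiset.mem_map, forall_exists_index, and_imp]
  rintro q w - rfl
  simp only [pointDist, hv, hγ]
  cases hw : s'.death w with
  | top =>
    have h3 := le_gamma_of_color_eq_true (hε := hε) (b := true)
      (color_eq_of_death_eq_top hs' hadd' hw)
    refine le_trans ?_ (le_add_right le_add_self)
    revert h3
    cases gamma (SimpleGraph.pathGraph 4) pathColor (.ofConf (colorStep hε true, colorSum)) w with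
    | top => exact fun _ => le_top
    | coe x =>
      intro h3
      replace h3 : 3 ≤ x := WithTop.coe_le_coe.1 h3
      change 1 ≤ ENNReal.ofReal |2 - x|
      rw [ENNReal.one_le_ofReal, abs_sub_comm]
      exact le_trans (by linarith) (le_abs_self _)
  | coe x =>
    refine le_add_right (le_add_right (le_add_right (le_max_of_le_right ?_)))
    exact le_top

end Path

end SpectRe

theorem theorem4p2 :
    (∀ (X : Type*) [Fintype X] [DecidableEq X]
      (f : SpectRe.Conf X Set.univ × SpectRe.Conf (Sym2 X) (Set.Ioi 0)),
      ∀ᶠ g : SpectRe.Conf X Set.univ × SpectRe.Conf (Sym2 X) (Set.Ioi 0) in 𝓝 f,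
        ∀ (V : Type*) [Fintype V] (G : SimpleGraph V) (c : V → X) (D E : SpectRe.Diagram),
          SpectRe.IsDiagram G c (SpectRe.ColorFiltration.ofConf f) D →
          SpectRe.IsDiagram G c (SpectRe.ColorFiltration.ofConf g) E →
          SpectRe.bottleneckDist D E ≤
            ENNReal.ofReal (3 * ‖f.2.1 - g.2.1‖ + ‖f.1.1 - g.1.1‖)) ∧
    (∃ (G : SimpleGraph (Fin 4)) (c : Fin 4 → Bool), ∀ C : ℝ,
      ∃ f g : SpectRe.Conf Bool Set.univ × SpectRe.Conf (Sym2 Bool) (Set.Ioi 0),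
        ∃ D E : SpectRe.Diagram,
          SpectRe.IsDiagram G c (SpectRe.ColorFiltration.ofConf f) D ∧
          SpectRe.IsDiagram G c (SpectRe.ColorFiltration.ofConf g) E ∧
          ENNReal.ofReal (C * (‖f.2.1 - g.2.1‖ + ‖f.1.1 - g.1.1‖)) <
            SpectRe.bottleneckDist D E) := by
  constructor
  · intro X _ _ f
    filter_upwards [SpectRe.eventually_sameOrder f] with g hg V _ G c D E hD hE
    exact hg.bottleneckDist_le (norm_nonneg _) (norm_nonneg _)
      (fun p => norm_le_pi_norm (f.2.1 - g.2.1) p) (fun x => norm_le_pi_norm (f.1.1 - g.1.1) x) hD hE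
  · refine ⟨SimpleGraph.pathGraph 4, SpectRe.pathColor, fun C => ?_⟩
    have hε : 0 < (|C| + 1)⁻¹ := by positivity
    obtain ⟨D, hD⟩ := SpectRe.exists_isDiagram (SimpleGraph.pathGraph 4) SpectRe.pathColor
      (.ofConf (SpectRe.colorStep hε false, SpectRe.colorSum))
    obtain ⟨E, hE⟩ := SpectRe.exists_isDiagram (SimpleGraph.pathGraph 4) SpectRe.pathColor
      (.ofConf (SpectRe.colorStep hε true, SpectRe.colorSum))
    refine ⟨_, _, D, E, hD, hE, lt_of_lt_of_le ?_ (SpectRe.one_le_bottleneckDist hD hE)⟩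
    rw [ENNReal.ofReal_lt_one, sub_self, norm_zero, zero_add]
    calc C * ‖(SpectRe.colorStep hε false).1 - (SpectRe.colorStep hε true).1‖
        ≤ |C| * (|C| + 1)⁻¹ := mul_le_mul (le_abs_self C)
          (SpectRe.norm_colorStep_sub_le hε false true) (norm_nonneg _) (abs_nonneg C)
      _ < 1 := by
        rw [← div_eq_mul_inv, div_lt_one (by positivity)]
        exact lt_add_one _
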